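/- Let $m\ge 0$, let $a_1,\dots,a_m,b_1,\dots,b_m,c\in\mathbb{C}$ be arbitrary, and let $D=\mathbb{C}[x_1,\dots,x_m]\langle\partial_1,\dots,\partial_m\rangle$ be the ring of differential operators with polynomial coefficients (the Weyl algebra). Put $\theta_i=x_i\partial_i$ and $$\ell_i^B=\theta_i(\theta_1+\cdots+\theta_m+c-1)-x_i(\theta_i+a_i)(\theta_i+b_i)\qquad(1\le i\le m),$$ and let $I_B(m)=D\cdot\{\ell_1^B,\dots,\ell_m^B\}$ be the left ideal that they generate. For $P=\sum_{\alpha,\beta}c_{\alpha,\beta}x^\alpha\partial^\beta\in D$ nonzero, the $(\mathbf 0,\mathbf 1)$-initial form $\mathrm{in}_{(\mathbf 0,\mathbf 1)}(P)\in\mathbb{C}[x,\xi]=\mathbb{C}[x_1,\dots,x_m,\xi_1,\dots,\xi_m]$ is the sum of the $c_{\alpha,\beta}x^\alpha\xi^\beta$ over those $(\alpha,\beta)$ for which $|\beta|=\beta_1+\cdots+\beta_m$ is maximal among all pairs with $c_{\alpha,\beta}\neq 0$; also $\mathrm{in}_{(\mathbf 0,\mathbf 1)}(0)=0$. For a left ideal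 $I$ of $D$ let $\mathrm{in}_{(\mathbf 0,\mathbf 1)}(I)$ be the ideal of $\mathbb{C}[x,\xi]$ generated by all $\mathrm{in}_{(\mathbf 0,\mathbf 1)}(P)$ with $P\in I$; the characteristic variety $\mathrm{Ch}(I)\subset\mathbb{C}^{2m}$ is the set of common zeros of $\mathrm{in}_{(\mathbf 0,\mathbf 1)}(I)$. Then, for every $i$, the $(\mathbf 0,\mathbf 1)$-initial form of $\ell_i^B$ is $$L_i^B=x_i\xi_i\Bigl(x_i(1-x_i)\xi_i+\sum_{1\le j\le m,\;j\ne i}x_j\xi_j\Bigr),$$ and $$\mathrm{Ch}(I_B(m))=\mathbf{V}(L_1^B,\dots,L_m^B)=\{(x,\xi)\in\mathbb{C}^{2m} : L_1^B(x,\xi)=\cdots=L_m^B(x,\xi)=0\}.$$ -/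

import Mathlib

noncomputable section

namespace LauricellaFB

open MvPolynomial

/-- The polynomial ring `ℂ[x₁, …, x_m]`. -/
abbrev Poly (m : ℕ) : Type := MvPolynomial (Fin m) ℂ

/-- The operator of multiplication by a polynomial on `ℂ[x₁, …, x_m]`. -/
def mulOp (m : ℕ) : Poly m →ₐ[ℂ] Module.End ℂ (Poly m) := Algebra.lmul ℂ (Poly m)

/-- The operator `∂/∂x_i` on `ℂ[x₁, …, x_m]`. -/
def derivOp (m : ℕ) (i : Fin m) : Module.End ℂ (Poly m) := (pderiv i).toLinearMap

theorem mulOp_apply {m : ℕ} (p q : Poly m) : mulOp m p q = p * q := rfl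

theorem derivOp_apply {m : ℕ} (i : Fin m) (p : Poly m) : derivOp m i p = pderiv i p := rfl

/-- The Weyl algebra `D = ℂ[x₁, …, x_m]⟨∂₁, …, ∂_m⟩`: the ring of differential operators
with polynomial coefficients, realized as the algebra of operators on `ℂ[x₁, …, x_m]`
generated by the multiplications by the `x_i` and by the `∂/∂x_i`. -/
def weylAlgebra (m : ℕ) : Subalgebra ℂ (Module.End ℂ (Poly m)) :=
  Algebra.adjoin ℂ (Set.range (fun i => mulOp m (X i)) ∪ Set.range (derivOp m))

/-- The Weyl algebra as a type. -/
abbrev D (m : ℕ) : Type := weylAlgebra m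

/-- The element `x_i` of `D`. -/
def x {m : ℕ} (i : Fin m) : D m :=
  ⟨mulOp m (X i), Algebra.subset_adjoin (Or.inl ⟨i, rfl⟩)⟩

/-- The element `∂_i` of `D`. -/
def d {m : ℕ} (i : Fin m) : D m :=
  ⟨derivOp m i, Algebra.subset_adjoin (Or.inr ⟨i, rfl⟩)⟩

theorem x_commute {m : ℕ} (i j : Fin m) : Commute (x i) (x j) := by
  apply Subtype.ext
  change mulOp m (X i) * mulOp m (X j) = mulOp m (X j) * mulOp m (X i)
  rw [← map_mul, ← map_mul, mul_comm]

theorem d_commute {m : ℕ} (i j : Fin m) : Commute (d i) (d j) := by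
  apply Subtype.ext
  change derivOp m i * derivOp m j = derivOp m j * derivOp m i
  refine (basisMonomials (Fin m) ℂ).ext fun s => ?_
  simp only [coe_basisMonomials, Module.End.mul_apply, derivOp_apply, pderiv_monomial]
  by_cases h : i = j
  · rw [h]
  · have h' : j ≠ i := fun e => h e.symm
    rw [tsub_right_comm]
    congr 1
    simp [h, h', mul_comm]

theorem xPow_pairwise {m : ℕ} (α : Fin m → ℕ) :
    ((Finset.univ : Finset (Fin m)) : Set (Fin m)).Pairwise
      (Function.onFun Commute fun i => (x i : D m) ^ α i) :=
  fun i _ j _ _ => (x_commute i j).pow_pow _ _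

theorem dPow_pairwise {m : ℕ} (β : Fin m → ℕ) :
    ((Finset.univ : Finset (Fin m)) : Set (Fin m)).Pairwise
      (Function.onFun Commute fun i => (d i : D m) ^ β i) :=
  fun i _ j _ _ => (d_commute i j).pow_pow _ _

/-- The product `x^α = x₁^α₁ ⋯ x_m^α_m` in `D`. -/
def xPow {m : ℕ} (α : Fin m → ℕ) : D m :=
  Finset.univ.noncommProd (fun i => x i ^ α i) (xPow_pairwise α)

/-- The product `∂^β = ∂₁^β₁ ⋯ ∂_m^β_m` in `D`. -/
def dPow {m : ℕ} (β : Fin m → ℕ) : D m :=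
  Finset.univ.noncommProd (fun i => d i ^ β i) (dPow_pairwise β)

/-- The commutative polynomial ring `ℂ[x₁, …, x_m, ξ₁, …, ξ_m]`; the variable `x_i` has the
index `Sum.inl i`, and `ξ_i` has the index `Sum.inr i`. -/
abbrev SymbolRing (m : ℕ) : Type := MvPolynomial (Fin m ⊕ Fin m) ℂ

/-- The normally ordered monomial `x^α ∂^β` of `D`, where `s = (α, β)`. -/
def normalMonomial {m : ℕ} (s : Fin m ⊕ Fin m →₀ ℕ) : D m :=
  xPow (fun i => s (Sum.inl i)) * dPow (fun i => s (Sum.inr i))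

/-- The linear map `∑ c_{α,β} x^α ξ^β ↦ ∑ c_{α,β} x^α ∂^β`. -/
def normalOrder (m : ℕ) : SymbolRing m →ₗ[ℂ] D m :=
  (basisMonomials (Fin m ⊕ Fin m) ℂ).constr ℂ normalMonomial

theorem normalOrder_monomial {m : ℕ} (s : Fin m ⊕ Fin m →₀ ℕ) (c : ℂ) :
    normalOrder m (monomial s c) = c • normalMonomial s := by
  have h : (monomial s c : SymbolRing m) = c • basisMonomials (Fin m ⊕ Fin m) ℂ s := by
    simp [smul_monomial]
  rw [h, map_smul, normalOrder, Module.Basis.constr_basis]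

theorem xPow_val {m : ℕ} (α : Fin m →₀ ℕ) :
    ((xPow α : D m) : Module.End ℂ (Poly m)) = mulOp m (monomial α 1) := by
  have hc : ((Finset.univ : Finset (Fin m)) : Set (Fin m)).Pairwise
      (Function.onFun Commute fun i => (X i : Poly m) ^ α i) := fun i _ j _ _ => Commute.all _ _
  have h1 : (monomial α 1 : Poly m) = Finset.univ.noncommProd (fun i => X i ^ α i) hc := by
    rw [Finset.noncommProd_eq_prod, monomial_eq, Finsupp.prod_fintype _ _ (fun i => pow_zero _)]
    simp
  rw [h1, Finset.map_noncommProd]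
  change (weylAlgebra m).val (xPow α) = _
  rw [xPow, Finset.map_noncommProd]
  refine Finset.noncommProd_congr rfl (fun i _ => ?_) _
  simp [x]

theorem derivOp_pow_monomial {m : ℕ} (i : Fin m) (k : ℕ) (γ : Fin m →₀ ℕ) (c : ℂ) :
    (derivOp m i ^ k) (monomial γ c) =
      monomial (γ - Finsupp.single i k) (c * ((γ i).descFactorial k : ℂ)) := by
  induction k with
  | zero => simp
  | succ k ih =>
    rw [pow_succ', Module.End.mul_apply, ih, derivOp_apply, pderiv_monomial, tsub_tsub, ← Finsupp.single_add,
      Nat.descFactorial_succ]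
    congr 1
    simp
    ring

theorem dPow_monomial {m : ℕ} (β γ : Fin m →₀ ℕ) :
    ((dPow β : D m) : Module.End ℂ (Poly m)) (monomial γ 1) =
      monomial (γ - β) (∏ i, ((γ i).descFactorial (β i) : ℂ)) := by
  classical
  change (weylAlgebra m).val (dPow β) _ = _
  rw [dPow, Finset.map_noncommProd]
  have key : ∀ S : Finset (Fin m), ∀ hS,
      (S.noncommProd (fun i => (weylAlgebra m).val (d i ^ β i)) hS) (monomial γ 1) =
      monomial (γ - ∑ i ∈ S, Finsupp.single i (β i))
        (∏ i ∈ S, ((γ i).descFactorial (β i) : ℂ)) := by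
    intro S
    induction S using Finset.induction_on with
    | empty => intro hS; simp
    | insert a S ha ih =>
      intro hS
      rw [Finset.noncommProd_insert_of_notMem _ _ _ _ ha, Module.End.mul_apply, ih]
      have h1 : (weylAlgebra m).val (d a ^ β a) = derivOp m a ^ β a := by
        rw [map_pow]; rfl
      have h2 : (γ - ∑ i ∈ S, Finsupp.single i (β i)) a = γ a := by
        rw [Finsupp.tsub_apply, Finsupp.finsetSum_apply, Finset.sum_eq_zero, tsub_zero]
        intro i hi
        exact Finsupp.single_eq_of_ne (fun h => ha (h ▸ hi))
      rw [h1, derivOp_pow_monomial, h2, tsub_tsub, Finset.sum_insert ha, Finset.prod_insert ha,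
        add_comm, mul_comm]
  refine (key _ _).trans ?_
  rw [Finsupp.univ_sum_single]

theorem d_mul_dPow {m : ℕ} (i : Fin m) (β : Fin m →₀ ℕ) :
    d i * dPow β = dPow (β + Finsupp.single i 1 : Fin m →₀ ℕ) := by
  classical
  rw [dPow, dPow, ← Finset.mul_noncommProd_erase Finset.univ (Finset.mem_univ i)
      (fun j => d j ^ β j) (dPow_pairwise β), ← Finset.mul_noncommProd_erase Finset.univ (Finset.mem_univ i)
      (fun j => d j ^ (β + Finsupp.single i 1 : Fin m →₀ ℕ) j) (dPow_pairwise _), ← mul_assoc]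
  congr 1
  · simp [pow_succ']
  · refine Finset.noncommProd_congr rfl (fun j hj => ?_) _
    have : j ≠ i := (Finset.mem_erase.mp hj).1
    simp [this.symm]

theorem d_mul_xPow {m : ℕ} (i : Fin m) (α : Fin m →₀ ℕ) :
    d i * xPow α = xPow α * d i + (α i : ℂ) • xPow (α - Finsupp.single i 1 : Fin m →₀ ℕ) := by
  apply Subtype.ext
  change derivOp m i * (xPow α : D m).1 = (xPow α : D m).1 * derivOp m i +
    (α i : ℂ) • (xPow (α - Finsupp.single i 1 : Fin m →₀ ℕ) : D m).1
  rw [xPow_val, xPow_val]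
  refine LinearMap.ext fun p => ?_
  simp only [mulOp_apply, derivOp_apply, Module.End.mul_apply, LinearMap.add_apply,
    LinearMap.smul_apply, pderiv_mul, pderiv_monomial]
  rw [← smul_mul_assoc, smul_monomial]
  simp [add_comm]

theorem x_mul_xPow {m : ℕ} (i : Fin m) (α : Fin m →₀ ℕ) :
    x i * xPow α = xPow (α + Finsupp.single i 1 : Fin m →₀ ℕ) := by
  apply Subtype.ext
  change mulOp m (X i) * (xPow α : D m).1 = _
  rw [xPow_val, xPow_val, ← map_mul, X, monomial_mul, add_comm, one_mul]

/-- The pair `(α, β)` as one exponent. -/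
def joinExp {m : ℕ} (α β : Fin m →₀ ℕ) : Fin m ⊕ Fin m →₀ ℕ := Finsupp.sumElim α β

theorem normalMonomial_joinExp {m : ℕ} (α β : Fin m →₀ ℕ) :
    normalMonomial (joinExp α β) = xPow α * dPow β := rfl

theorem exists_joinExp {m : ℕ} (s : Fin m ⊕ Fin m →₀ ℕ) :
    ∃ α β : Fin m →₀ ℕ, s = joinExp α β := by
  refine ⟨Finsupp.equivFunOnFinite.symm fun i => s (Sum.inl i),
    Finsupp.equivFunOnFinite.symm fun i => s (Sum.inr i), ?_⟩
  ext (i | i) <;> simp [joinExp]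

theorem normalMonomial_mem {m : ℕ} (s : Fin m ⊕ Fin m →₀ ℕ) :
    normalMonomial s ∈ LinearMap.range (normalOrder m) :=
  ⟨monomial s 1, by rw [normalOrder_monomial, one_smul]⟩

theorem normalOrder_mem_of_monomial {m : ℕ} (P : D m)
    (h : ∀ s, P * normalMonomial s ∈ LinearMap.range (normalOrder m)) (p : SymbolRing m) :
    P * normalOrder m p ∈ LinearMap.range (normalOrder m) := by
  induction p using MvPolynomial.induction_on' with
  | monomial s c =>
    rw [normalOrder_monomial, mul_smul_comm]
    exact Submodule.smul_mem _ _ (h s)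
  | add p q hp hq =>
    rw [map_add, mul_add]
    exact Submodule.add_mem _ hp hq

theorem normalOrder_surjective (m : ℕ) : Function.Surjective (normalOrder m) := by
  have key : ∀ (P : Module.End ℂ (Poly m)) (hP : P ∈ weylAlgebra m) (p : SymbolRing m),
      (⟨P, hP⟩ : D m) * normalOrder m p ∈ LinearMap.range (normalOrder m) := by
    intro P hP
    induction hP using Algebra.adjoin_induction with
    | mem P hP =>
      refine normalOrder_mem_of_monomial _ fun s => ?_
      obtain ⟨α, β, rfl⟩ := exists_joinExp s
      rcases hP with ⟨i, rfl⟩ | ⟨i, rfl⟩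
      · change x i * _ ∈ _
        rw [normalMonomial_joinExp, ← mul_assoc, x_mul_xPow, ← normalMonomial_joinExp]
        exact normalMonomial_mem _
      · change d i * _ ∈ _
        rw [normalMonomial_joinExp, ← mul_assoc, d_mul_xPow, add_mul, mul_assoc, d_mul_dPow,
          smul_mul_assoc, ← normalMonomial_joinExp, ← normalMonomial_joinExp]
        exact Submodule.add_mem _ (normalMonomial_mem _)
          (Submodule.smul_mem _ _ (normalMonomial_mem _))
    | algebraMap r =>
      intro p
      refine ⟨r • p, ?_⟩
      rw [map_smul, Algebra.smul_def]
      rfl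
    | add P Q hP hQ h1 h2 =>
      intro p
      have := Submodule.add_mem _ (h1 p) (h2 p)
      rwa [← add_mul] at this
    | mul P Q hP hQ h1 h2 =>
      intro p
      obtain ⟨q, hq⟩ := h2 p
      have := h1 q
      rwa [hq, ← mul_assoc] at this
  intro P
  have h1 : normalOrder m 1 = 1 := by
    have := normalOrder_monomial (m := m) 0 1
    rw [one_smul] at this
    change normalOrder m (monomial 0 1) = 1
    rw [this]
    have hx : (xPow (fun i => (0 : Fin m ⊕ Fin m →₀ ℕ) (Sum.inl i)) : D m) = 1 :=
      (Finset.noncommProd_eq_pow_card _ _ _ 1 fun _ _ => pow_zero _).trans (one_pow _)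
    have hd : (dPow (fun i => (0 : Fin m ⊕ Fin m →₀ ℕ) (Sum.inr i)) : D m) = 1 :=
      (Finset.noncommProd_eq_pow_card _ _ _ 1 fun _ _ => pow_zero _).trans (one_pow _)
    rw [normalMonomial, hx, hd, one_mul]
  have := key P.1 P.2 1
  rw [h1, mul_one] at this
  exact this

theorem normalOrder_apply_monomial {m : ℕ} (p : SymbolRing m) (γ : Fin m →₀ ℕ) :
    ((normalOrder m p : D m) : Module.End ℂ (Poly m)) (monomial γ 1) =
      ∑ s ∈ p.support, monomial
        ((Finsupp.comapDomain Sum.inl s Sum.inl_injective.injOn) +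
          (γ - Finsupp.comapDomain Sum.inr s Sum.inr_injective.injOn))
        (coeff s p * ∏ i, ((γ i).descFactorial (s (Sum.inr i)) : ℂ)) := by
  conv_lhs => rw [p.as_sum]
  change (weylAlgebra m).val.toLinearMap (normalOrder m _) _ = _
  rw [map_sum, map_sum, LinearMap.sum_apply]
  refine Finset.sum_congr rfl fun s _ => ?_
  obtain ⟨α, β, rfl⟩ := exists_joinExp s
  have hα : Finsupp.comapDomain Sum.inl (joinExp α β) Sum.inl_injective.injOn = α := by
    ext i; simp [joinExp]
  have hβ : Finsupp.comapDomain Sum.inr (joinExp α β) Sum.inr_injective.injOn = β := by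
    ext i; simp [joinExp]
  rw [hα, hβ, normalOrder_monomial, normalMonomial_joinExp]
  change (coeff (joinExp α β) p • ((xPow α : D m).1 * (dPow β : D m).1)) (monomial γ 1) = _
  rw [LinearMap.smul_apply, Module.End.mul_apply, dPow_monomial, xPow_val, mulOp_apply,
    monomial_mul, smul_monomial, one_mul]
  rfl

theorem normalOrder_injective (m : ℕ) : Function.Injective (normalOrder m) := by
  classical
  refine (injective_iff_map_eq_zero (normalOrder m)).mpr fun p hp => ?_
  have key : ∀ n : ℕ, ∀ α β : Fin m →₀ ℕ, β.degree = n → coeff (joinExp α β) p = 0 := by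
    intro n
    induction n using Nat.strong_induction_on with
    | _ n ih =>
      intro α β hβ
      have h := normalOrder_apply_monomial p β
      rw [hp] at h
      replace h := congrArg (coeff α) h
      rw [coeff_sum] at h
      rw [Finset.sum_eq_single (joinExp α β)] at h
      · have hα : Finsupp.comapDomain Sum.inl (joinExp α β) Sum.inl_injective.injOn = α := by
          ext i; simp [joinExp]
        have hβ' : Finsupp.comapDomain Sum.inr (joinExp α β) Sum.inr_injective.injOn = β := by
          ext i; simp [joinExp]
        rw [hα, hβ', tsub_self, add_zero, coeff_monomial, if_pos rfl] at h
        have h0 : coeff (joinExp α β) p *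
            ∏ i, ((β i).descFactorial (joinExp α β (Sum.inr i)) : ℂ) = 0 := by
          rw [← h]; simp
        rcases mul_eq_zero.mp h0 with h0 | h0
        · exact h0
        · exfalso
          obtain ⟨i, -, hi⟩ := Finset.prod_eq_zero_iff.mp h0
          have : (β i).descFactorial (β i) = 0 := by exact_mod_cast hi
          rw [Nat.descFactorial_self] at this
          exact Nat.factorial_ne_zero _ this
      · intro s _ hs
        obtain ⟨α', β', rfl⟩ := exists_joinExp s
        have hα : Finsupp.comapDomain Sum.inl (joinExp α' β') Sum.inl_injective.injOn = α' := by
          ext i; simp [joinExp]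
        have hβ' : Finsupp.comapDomain Sum.inr (joinExp α' β') Sum.inr_injective.injOn = β' := by
          ext i; simp [joinExp]
        rw [hα, hβ']
        by_cases hle : β' ≤ β
        · by_cases heq : β' = β
          · subst heq
            rw [tsub_self, add_zero, coeff_monomial, if_neg]
            rintro rfl
            exact hs rfl
          · have hlt : β'.degree < n := by
              rw [← hβ, ← tsub_add_cancel_of_le hle, map_add]
              have : (β - β').degree ≠ 0 := by
                rw [Ne, Finsupp.degree_eq_zero_iff]
                intro h0
                exact heq (le_antisymm hle (tsub_eq_zero_iff_le.mp h0))
              omega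
            rw [ih _ hlt α' β' rfl]
            simp
        · have : ∃ i, β i < β' i := by
            by_contra! hcon
            exact hle hcon
          obtain ⟨i, hi⟩ := this
          rw [Finset.prod_eq_zero (Finset.mem_univ i)]
          · simp
          · have : (β i).descFactorial (β' i) = 0 := Nat.descFactorial_eq_zero_iff_lt.mpr hi
            exact_mod_cast this
      · intro hs
        rw [notMem_support_iff.mp hs]
        simp
  ext s
  obtain ⟨α, β, rfl⟩ := exists_joinExp s
  rw [key _ α β rfl, coeff_zero]

/-- Every `P ∈ D` is `∑ c_{α,β} x^α ∂^β` for exactly one polynomial `∑ c_{α,β} x^α ξ^β`. -/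
theorem normalOrder_bijective (m : ℕ) : Function.Bijective (normalOrder m) :=
  ⟨normalOrder_injective m, normalOrder_surjective m⟩

/-- The total symbol `∑ c_{α,β} x^α ξ^β` of `P = ∑ c_{α,β} x^α ∂^β`. -/
def totalSymbol {m : ℕ} (P : D m) : SymbolRing m :=
  (LinearEquiv.ofBijective (normalOrder m) (normalOrder_bijective m)).symm P

/-- The weight vector `(0, 1)`: each `x_i` has weight `0` and each `ξ_i` has weight `1`. -/
def weight01 (m : ℕ) : Fin m ⊕ Fin m → ℕ := Sum.elim (fun _ => 0) (fun _ => 1)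

/-- The `(0, 1)`-initial form of `P ∈ D`: the sum of the terms of highest `(0, 1)`-weight in
the total symbol of `P` (and `0` for `P = 0`). -/
def initialForm {m : ℕ} (P : D m) : SymbolRing m :=
  weightedHomogeneousComponent (weight01 m)
    (weightedTotalDegree (weight01 m) (totalSymbol P)) (totalSymbol P)

/-- The `(0, 1)`-initial form ideal of a left ideal `I` of `D`. -/
def initialIdeal {m : ℕ} (I : Ideal (D m)) : Ideal (SymbolRing m) :=
  Ideal.span {f | ∃ P ∈ I, f = initialForm P}

/-- The characteristic variety of a left ideal `I` of `D`, a subset of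
`ℂ^{2m} = {(x₁, …, x_m, ξ₁, …, ξ_m)}`. -/
def characteristicVariety {m : ℕ} (I : Ideal (D m)) : Set (Fin m ⊕ Fin m → ℂ) :=
  zeroLocus ℂ (initialIdeal I)

/-- The Euler operator `θ_i = x_i ∂_i`. -/
def euler {m : ℕ} (i : Fin m) : D m := x i * d i

/-- The operator
`ℓ_i^B = θ_i (θ₁ + ⋯ + θ_m + c - 1) - x_i (θ_i + a_i) (θ_i + b_i)`. -/
def ellB {m : ℕ} (a b : Fin m → ℂ) (c : ℂ) (i : Fin m) : D m :=
  euler i * (∑ j, euler j + algebraMap ℂ (D m) (c - 1)) -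
    x i * (euler i + algebraMap ℂ (D m) (a i)) * (euler i + algebraMap ℂ (D m) (b i))

/-- The left ideal `I_B(m)` of `D` generated by `ℓ_1^B, …, ℓ_m^B` (for a noncommutative ring,
`Ideal` means left ideal). -/
def idealB {m : ℕ} (a b : Fin m → ℂ) (c : ℂ) : Ideal (D m) :=
  Ideal.span (Set.range (ellB a b c))

/-- The polynomial `L_i^B = x_i ξ_i (x_i (1 - x_i) ξ_i + ∑_{j ≠ i} x_j ξ_j)`. -/
def LB {m : ℕ} (i : Fin m) : SymbolRing m :=
  X (Sum.inl i) * X (Sum.inr i) *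
    (X (Sum.inl i) * (1 - X (Sum.inl i)) * X (Sum.inr i) +
      ∑ j ∈ Finset.univ.erase i, X (Sum.inl j) * X (Sum.inr j))

end LauricellaFB

end

namespace LauricellaFB

open MvPolynomial

/-! ### Koszul syzygies in commutative rings. -/

section Koszul

/-! The stronger fact proved is that the initial ideal of `idealB` is generated by the `L_i`
themselves; the variety follows by taking zeros. Let `P = ∑ Q_i ℓ_i`. If no cancellation occurs at
the top order, the symbol of `P` is `∑ σ(Q_i) L_i`. If cancellation occurs, the top symbols of the
`Q_i` form a syzygy of the `L_i`, and two facts allow the `Q_i` to be replaced by operators of lower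
order with the same sum.

First, all syzygies of the `L_i` are Koszul (`hasKoszulSyzygies_LB`). For the ordinary total degree
the leading form of `L_i` is `-x_i³ ξ_i²`; these are monomials in disjoint sets of variables, so
their syzygies are Koszul, and the property lifts from leading forms to the polynomials
(`HasKoszulSyzygies.of_component`).

Second, each Koszul syzygy lifts to an exact relation in `D`, namely `(ℓ_j - θ_j) ℓ_i = (ℓ_i - θ_i)
ℓ_j` (`ellB_sub_euler_mul_ellB`), where `ℓ_j - θ_j` still has symbol `L_j`.

Induction on the order of the `Q_i` (`symbolAt_mem_of_sum`) then puts every symbol in the ideal of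
the `L_i`. It holds for arbitrary parameters, which enter only below the leading order. -/

theorem sum_sum_eq_zero_of_antisymm {ι A : Type*} [Fintype ι] [AddCommGroup A]
    [IsAddTorsionFree A] {f : ι → ι → A} (hf : ∀ i j, f i j = -f j i) :
    ∑ i, ∑ j, f i j = 0 := by
  have h : ∑ i, ∑ j, f i j = -∑ i, ∑ j, f i j := by
    conv_lhs => rw [Finset.sum_comm]
    rw [← Finset.sum_neg_distrib]
    refine Finset.sum_congr rfl fun i _ => ?_
    rw [← Finset.sum_neg_distrib]
    exact Finset.sum_congr rfl fun j _ => hf j i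
  exact self_eq_neg.mp h

/-- All syzygies of the family `r` are combinations of the Koszul syzygies `r_j e_i - r_i e_j`. -/
def HasKoszulSyzygies {ι R : Type*} [Fintype ι] [CommRing R] (r : ι → R) : Prop :=
  ∀ q : ι → R, ∑ i, q i * r i = 0 →
    ∃ u : ι → ι → R, (∀ i j, u i j = -u j i) ∧ ∀ i, q i = ∑ j, u i j * r j

/-- Generators are added one at a time. In a relation over `insert a S`, the term `q a * r a` lies
in the ideal of `S`, so `q a = ∑ c i * r i`; removing the Koszul syzygies with coefficients `c i`
leaves a relation over `S` alone. -/
theorem HasKoszulSyzygies.of_nonzerodivisors {ι R : Type*} [Fintype ι] [CommRing R] {r : ι → R}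
    (h : ∀ (S : Finset ι) (a : ι), a ∉ S → ∀ f : R,
      f * r a ∈ Ideal.span (r '' S) → f ∈ Ideal.span (r '' S)) :
    HasKoszulSyzygies r := by
  classical
  have key : ∀ (S : Finset ι) (q : ι → R), ∑ i ∈ S, q i * r i = 0 →
      ∃ u : ι → ι → R, (∀ i j, u i j = -u j i) ∧ ∀ i ∈ S, q i = ∑ j ∈ S, u i j * r j := by
    intro S
    induction S using Finset.induction_on with
    | empty => exact fun q _ => ⟨0, by simp, by simp⟩
    | insert a S ha ih =>
      intro q hq
      rw [Finset.sum_insert ha] at hq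
      have hmem : q a * r a ∈ Ideal.span (r '' S) := by
        rw [eq_neg_of_add_eq_zero_left hq]
        exact neg_mem (Ideal.sum_mem _ fun i hi =>
          Ideal.mul_mem_left _ _ (Ideal.subset_span ⟨i, hi, rfl⟩))
      obtain ⟨c, hc⟩ := (Submodule.mem_span_image_finset_iff_exists_fun' R).mp (h S a ha _ hmem)
      simp only [smul_eq_mul] at hc
      obtain ⟨u, hu, huq⟩ := ih (fun i => q i + c i * r a) (by
        rw [← hq, ← hc, Finset.sum_mul, ← Finset.sum_add_distrib]
        exact Finset.sum_congr rfl fun i _ => by ring)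
      have hne : ∀ i ∈ S, i ≠ a := fun i hi e => ha (e ▸ hi)
      -- The matrix `u` bordered by the row `c` and the column `-c` at index `a`.
      refine ⟨fun i j => if i = a then (if j = a then 0 else c j) else
        if j = a then -c i else u i j, fun i j => ?_, fun i hi => ?_⟩
      · by_cases h1 : i = a <;> by_cases h2 : j = a <;> simp [h1, h2, hu i j]
      · rw [Finset.sum_insert ha]
        rcases Finset.mem_insert.mp hi with rfl | hi
        · rw [← hc]
          simp only [if_true, zero_mul, zero_add]
          exact Finset.sum_congr rfl fun j hj => by rw [if_neg (hne j hj)]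
        · have h1 := huq i hi
          simp only [if_true, if_neg (hne i hi)]
          rw [Finset.sum_congr rfl fun j hj => by rw [if_neg (hne j hj)], ← h1]
          ring
  intro q hq
  obtain ⟨u, hu, huq⟩ := key Finset.univ q hq
  exact ⟨u, hu, fun i => huq i (Finset.mem_univ i)⟩

/-- In a monomial ideal membership is tested monomial by monomial. If `e i` divides `s + e a` and
shares no variable with `e a`, it already divides `s`, so each monomial is a nonzerodivisor modulo
the others. -/
theorem HasKoszulSyzygies.monomial {ι σ R : Type*} [Fintype ι] [CommRing R] (e : ι → σ →₀ ℕ)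
    (he : ∀ i j, i ≠ j → Disjoint (e i).support (e j).support) :
    HasKoszulSyzygies fun i => MvPolynomial.monomial (e i) (1 : R) := by
  classical
  refine .of_nonzerodivisors fun S a ha f hf => ?_
  have himg : (fun i => MvPolynomial.monomial (e i) (1 : R)) '' (S : Set ι) =
      (fun s => MvPolynomial.monomial s (1 : R)) '' (e '' (S : Set ι)) := by
    rw [Set.image_image]
  rw [himg, mem_ideal_span_monomial_image] at hf ⊢
  intro s hs
  obtain ⟨_, ⟨i, hi, rfl⟩, hle⟩ := hf (s + e a) (by
    rw [mem_support_iff, coeff_mul_monomial, mul_one]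
    exact mem_support_iff.mp hs)
  refine ⟨e i, ⟨i, hi, rfl⟩, fun v => ?_⟩
  by_cases hv : v ∈ (e i).support
  · have hv' := Finset.disjoint_left.mp (he i a fun h => ha (h ▸ hi)) hv
    have := hle v
    rwa [Finsupp.add_apply, Finsupp.notMem_support_iff.mp hv', add_zero] at this
  · rw [Finsupp.notMem_support_iff.mp hv]
    exact Nat.zero_le _

end Koszul

/-! ### Weight filtration on polynomials and lifting of syzygies from leading forms. -/

section WeightFiltration

variable {σ R : Type*} [CommRing R]

/-- The polynomials all of whose monomials have weight less than `n`. -/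
def weightLT (R : Type*) [CommRing R] (w : σ → ℕ) (n : ℕ) : Submodule R (MvPolynomial σ R) where
  carrier := {p | ∀ s, coeff s p ≠ 0 → Finsupp.weight w s < n}
  zero_mem' := by simp
  add_mem' {p q} hp hq s hs := by
    by_cases h : coeff s p = 0
    · exact hq s fun h' => hs (by rw [coeff_add, h, h', add_zero])
    · exact hp s h
  smul_mem' c p hp s hs := hp s fun h => hs (by rw [coeff_smul, h, smul_zero])

variable {w : σ → ℕ} {p q : MvPolynomial σ R} {k n : ℕ}

theorem weightLT_mono (h : k ≤ n) : weightLT R w k ≤ weightLT R w n :=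
  fun _ hp s hs => (hp s hs).trans_le h

/-- The strict bound makes level `0` trivial, so inductions on the level end here; weight at most
`n` is level `n + 1`. -/
theorem eq_zero_of_mem_weightLT_zero (hp : p ∈ weightLT R w 0) : p = 0 := by
  ext s
  by_contra h
  exact Nat.not_lt_zero _ (hp s h)

theorem IsWeightedHomogeneous.mem_weightLT (hp : IsWeightedHomogeneous w p k) :
    p ∈ weightLT R w (k + 1) := fun _ hs => Nat.lt_succ_of_le (hp hs).le

theorem mem_weightLT_weightedTotalDegree (w : σ → ℕ) (p : MvPolynomial σ R) :
    p ∈ weightLT R w (weightedTotalDegree w p + 1) := fun _ hs =>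
  Nat.lt_succ_of_le (le_weightedTotalDegree w (mem_support_iff.mpr hs))

theorem weightedHomogeneousComponent_eq_zero_of_mem_weightLT (hp : p ∈ weightLT R w k)
    (h : k ≤ n) : weightedHomogeneousComponent w n p = 0 :=
  weightedHomogeneousComponent_eq_zero' _ _ fun s hs hn =>
    absurd (hp s (mem_support_iff.mp hs)) (by omega)

theorem sub_weightedHomogeneousComponent_mem_weightLT (hp : p ∈ weightLT R w (k + 1)) :
    p - weightedHomogeneousComponent w k p ∈ weightLT R w k := by
  intro s hs
  rw [coeff_sub, coeff_weightedHomogeneousComponent] at hs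
  split_ifs at hs with h
  · simp at hs
  · rw [sub_zero] at hs
    have := hp s hs
    omega

theorem mem_weightLT_of_component_eq_zero (hp : p ∈ weightLT R w (k + 1))
    (h : weightedHomogeneousComponent w k p = 0) : p ∈ weightLT R w k := by
  simpa [h] using sub_weightedHomogeneousComponent_mem_weightLT hp

theorem mul_mem_weightLT (hp : p ∈ weightLT R w k) (hq : q ∈ weightLT R w (n + 1)) :
    p * q ∈ weightLT R w (k + n) := by
  classical
  intro s hs
  rw [coeff_mul] at hs
  obtain ⟨⟨a, b⟩, hab, h⟩ := Finset.exists_ne_zero_of_sum_ne_zero hs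
  rw [← Finset.HasAntidiagonal.mem_antidiagonal.mp hab, map_add]
  have h1 := hp a (left_ne_zero_of_mul h)
  have h2 := hq b (right_ne_zero_of_mul h)
  dsimp only
  omega

/-- Replacing either factor by its leading component changes the product only in weights below `k +
n`. -/
theorem component_mul_of_mem_weightLT (hp : p ∈ weightLT R w (k + 1))
    (hq : q ∈ weightLT R w (n + 1)) :
    weightedHomogeneousComponent w (k + n) (p * q) =
      weightedHomogeneousComponent w k p * weightedHomogeneousComponent w n q := by
  set p₀ := weightedHomogeneousComponent w k p with hp₀
  set q₀ := weightedHomogeneousComponent w n q with hq₀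
  have hph : IsWeightedHomogeneous w p₀ k := weightedHomogeneousComponent_isWeightedHomogeneous _ _
  have hqh : IsWeightedHomogeneous w q₀ n := weightedHomogeneousComponent_isWeightedHomogeneous _ _
  have h1 : (p - p₀) * q ∈ weightLT R w (k + n) :=
    mul_mem_weightLT (sub_weightedHomogeneousComponent_mem_weightLT hp) hq
  have h2 : (q - q₀) * p₀ ∈ weightLT R w (k + n) := by
    rw [add_comm]
    exact mul_mem_weightLT (sub_weightedHomogeneousComponent_mem_weightLT hq)
      (IsWeightedHomogeneous.mem_weightLT hph)
  have h : p * q = p₀ * q₀ + ((p - p₀) * q + (q - q₀) * p₀) := by ring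
  rw [h, map_add, weightedHomogeneousComponent_eq_zero_of_mem_weightLT (add_mem h1 h2) le_rfl,
    add_zero, (hph.mul hqh).weightedHomogeneousComponent_same]

attribute [local instance] MvPolynomial.weightedGradedAlgebra

theorem component_mul_of_isWeightedHomogeneous (p : MvPolynomial σ R)
    (hq : IsWeightedHomogeneous w q n) (k : ℕ) :
    weightedHomogeneousComponent w (k + n) (p * q) = weightedHomogeneousComponent w k p * q := by
  have := DirectSum.coe_decompose_mul_add_of_right_mem (weightedHomogeneousSubmodule R w)
    (i := k) (a := p) hq
  simpa only [← weightedDecomposition.decompose'_apply] using! this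

theorem component_mul_of_isWeightedHomogeneous_of_lt (p : MvPolynomial σ R)
    (hq : IsWeightedHomogeneous w q n) (h : k < n) :
    weightedHomogeneousComponent w k (p * q) = 0 := by
  have := DirectSum.coe_decompose_mul_of_right_mem_of_not_le (weightedHomogeneousSubmodule R w)
    (n := k) (a := p) hq (by omega)
  simpa only [← weightedDecomposition.decompose'_apply] using! this

/-- Taking the component of weight `n - d` of an antisymmetric matrix keeps it antisymmetric and
still represents `q`. When `n < d` no such component exists, which forces `q = 0`. -/
theorem HasKoszulSyzygies.homogeneous {ι : Type*} [Fintype ι] {y : ι → MvPolynomial σ R} {d : ℕ}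
    (hK : HasKoszulSyzygies y) (hy : ∀ i, IsWeightedHomogeneous w (y i) d)
    {q : ι → MvPolynomial σ R} (hq : ∀ i, IsWeightedHomogeneous w (q i) n)
    (h0 : ∑ i, q i * y i = 0) :
    (∀ i, q i = 0) ∨ ∃ (k : ℕ) (u : ι → ι → MvPolynomial σ R), k + d = n ∧
      (∀ i j, u i j = -u j i) ∧ (∀ i j, IsWeightedHomogeneous w (u i j) k) ∧
        ∀ i, q i = ∑ j, u i j * y j := by
  obtain ⟨u, hu, huq⟩ := hK q h0
  rcases lt_or_ge n d with h | h
  · left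
    intro i
    rw [← (hq i).weightedHomogeneousComponent_same, huq i, map_sum]
    exact Finset.sum_eq_zero fun j _ =>
      component_mul_of_isWeightedHomogeneous_of_lt (u i j) (hy j) h
  · right
    obtain ⟨k, rfl⟩ := Nat.exists_eq_add_of_le' h
    refine ⟨k, fun i j => weightedHomogeneousComponent w k (u i j), rfl, fun i j => ?_,
      fun i j => weightedHomogeneousComponent_isWeightedHomogeneous _ _, fun i => ?_⟩
    · exact (congrArg _ (hu i j)).trans (map_neg _ _)
    · rw [← (hq i).weightedHomogeneousComponent_same, huq i, map_sum]
      exact Finset.sum_congr rfl fun j _ =>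
        component_mul_of_isWeightedHomogeneous (u i j) (hy j) k

/-- The leading part of a syzygy of `r` is a syzygy of the leading forms, hence Koszul. The same
matrix applied to `r` is a genuine syzygy with this leading part; subtracting it lowers the weight,
and induction finishes. -/
theorem HasKoszulSyzygies.of_component {ι : Type*} [Fintype ι]
    [IsAddTorsionFree (MvPolynomial σ R)] {r : ι → MvPolynomial σ R} {d : ℕ}
    (hr : ∀ i, r i ∈ weightLT R w (d + 1))
    (hK : HasKoszulSyzygies fun i => weightedHomogeneousComponent w d (r i)) :
    HasKoszulSyzygies r := by
  have key : ∀ (n : ℕ) (q : ι → MvPolynomial σ R), (∀ i, q i ∈ weightLT R w n) →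
      ∑ i, q i * r i = 0 → ∃ u : ι → ι → MvPolynomial σ R,
        (∀ i j, u i j = -u j i) ∧ ∀ i, q i = ∑ j, u i j * r j := by
    intro n
    induction n with
    | zero => exact fun q hq _ => ⟨0, by simp, fun i => by simp [eq_zero_of_mem_weightLT_zero (hq i)]⟩
    | succ n ih =>
      intro q hq h0
      have htop : ∑ i, weightedHomogeneousComponent w n (q i) *
          weightedHomogeneousComponent w d (r i) = 0 := by
        rw [Finset.sum_congr rfl fun i _ => (component_mul_of_mem_weightLT (hq i) (hr i)).symm,
          ← map_sum, h0, map_zero]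
      rcases hK.homogeneous (fun i => weightedHomogeneousComponent_isWeightedHomogeneous _ _)
        (fun i => weightedHomogeneousComponent_isWeightedHomogeneous _ _) htop with
        hz | ⟨k, u, rfl, hu, huk, huq⟩
      · exact ih q (fun i => mem_weightLT_of_component_eq_zero (hq i) (hz i)) h0
      · obtain ⟨v, hv, hvq⟩ := ih (fun i => q i - ∑ j, u i j * r j) (fun i => by
          have hur : ∀ j, u i j * r j ∈ weightLT R w (k + d + 1) := fun j => by
            have := mul_mem_weightLT (IsWeightedHomogeneous.mem_weightLT (huk i j)) (hr j)
            rwa [show k + 1 + d = k + d + 1 by ring] at this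
          refine mem_weightLT_of_component_eq_zero
            (sub_mem (hq i) (sum_mem fun j _ => hur j)) ?_
          rw [map_sub, map_sum, huq i, sub_eq_zero]
          refine Finset.sum_congr rfl fun j _ => ?_
          rw [component_mul_of_mem_weightLT (IsWeightedHomogeneous.mem_weightLT (huk i j)) (hr j),
            (huk i j).weightedHomogeneousComponent_same]) (by
          -- The subtracted family is a Koszul syzygy, so the relation is preserved.
          have hz : ∑ i, ∑ j, u i j * r j * r i = 0 :=
            sum_sum_eq_zero_of_antisymm fun i j => by rw [hu i j]; ring
          simp only [sub_mul, Finset.sum_sub_distrib, h0, Finset.sum_mul, hz, sub_zero])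
        refine ⟨fun i j => u i j + v i j, fun i j => by
          linear_combination hu i j + hv i j, fun i => ?_⟩
        rw [← sub_add_cancel (q i) (∑ j, u i j * r j), hvq i, ← Finset.sum_add_distrib]
        exact Finset.sum_congr rfl fun j _ => by ring
  intro q h0
  refine key (Finset.univ.sup fun i => weightedTotalDegree w (q i) + 1) q (fun i => ?_) h0
  exact weightLT_mono (Finset.le_sup (f := fun i => weightedTotalDegree w (q i) + 1)
    (Finset.mem_univ i)) (mem_weightLT_weightedTotalDegree w (q i))

end WeightFiltration

end LauricellaFB

namespace LauricellaFB

open MvPolynomial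

theorem HasKoszulSyzygies.neg {ι R : Type*} [Fintype ι] [CommRing R] {r : ι → R}
    (h : HasKoszulSyzygies r) : HasKoszulSyzygies fun i => -r i := by
  intro q hq
  obtain ⟨u, hu, huq⟩ := h q (by simpa using hq)
  exact ⟨fun i j => -u i j, fun i j => congrArg Neg.neg (hu i j), fun i => by simpa using huq i⟩

/-! ### The polynomials `L_i` and their syzygies. -/

section Symbols

variable {m : ℕ}

/-- Separates the parts of total degree 4 and 5; completing the sum over all `j` absorbs the term
`x_i ξ_i`. -/
theorem LB_eq (i : Fin m) :
    LB i = X (Sum.inl i) * X (Sum.inr i) * ∑ j, X (Sum.inl j) * X (Sum.inr j) -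
      X (Sum.inl i) ^ 3 * X (Sum.inr i) ^ 2 := by
  rw [LB, ← Finset.add_sum_erase _ _ (Finset.mem_univ i)]
  ring

theorem isWeightedHomogeneous_LB (i : Fin m) : IsWeightedHomogeneous (weight01 m) (LB i) 2 := by
  have hx : ∀ j : Fin m, IsWeightedHomogeneous (weight01 m) (X (Sum.inl j) : SymbolRing m) 0 :=
    fun j => isWeightedHomogeneous_X _ _ _
  have hξ : ∀ j : Fin m, IsWeightedHomogeneous (weight01 m) (X (Sum.inr j) : SymbolRing m) 1 :=
    fun j => isWeightedHomogeneous_X _ _ _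
  rw [LB_eq]
  exact (((hx i).mul (hξ i)).mul (IsWeightedHomogeneous.sum _ _ _ fun j _ => (hx j).mul (hξ j))).sub
    (((hx i).pow 3).mul ((hξ i).pow 2))

theorem hasKoszulSyzygies_LB (m : ℕ) : HasKoszulSyzygies (LB : Fin m → SymbolRing m) := by
  have hX : ∀ v : Fin m ⊕ Fin m,
      IsWeightedHomogeneous (fun _ => 1 : Fin m ⊕ Fin m → ℕ) (X v : SymbolRing m) 1 :=
    fun v => isWeightedHomogeneous_X _ _ _
  have h5 : ∀ i : Fin m, IsWeightedHomogeneous (fun _ => 1 : Fin m ⊕ Fin m → ℕ)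
      (X (Sum.inl i) ^ 3 * X (Sum.inr i) ^ 2 : SymbolRing m) 5 :=
    fun i => ((hX _).pow 3).mul ((hX _).pow 2)
  have h4 : ∀ i : Fin m, IsWeightedHomogeneous (fun _ => 1 : Fin m ⊕ Fin m → ℕ)
      (X (Sum.inl i) * X (Sum.inr i) * ∑ j, X (Sum.inl j) * X (Sum.inr j) : SymbolRing m) 4 :=
    fun i => ((hX _).mul (hX _)).mul
      (IsWeightedHomogeneous.sum _ _ 2 fun j _ => (hX (Sum.inl j)).mul (hX (Sum.inr j)))
  refine HasKoszulSyzygies.of_component (w := fun _ => 1) (d := 5) (fun i => ?_) ?_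
  · rw [LB_eq]
    exact sub_mem (weightLT_mono (by omega) (IsWeightedHomogeneous.mem_weightLT (h4 i)))
      (IsWeightedHomogeneous.mem_weightLT (h5 i))
  · have htop : (fun i : Fin m => weightedHomogeneousComponent (fun _ => 1) 5 (LB i)) =
        fun i => -monomial
          (Finsupp.single (Sum.inl i) 3 + Finsupp.single (Sum.inr i) 2) (1 : ℂ) := by
      funext i
      rw [LB_eq, map_sub, (h5 i).weightedHomogeneousComponent_same,
        (h4 i).weightedHomogeneousComponent_ne _ (by omega), zero_sub, X_pow_eq_monomial,
        X_pow_eq_monomial, monomial_mul, one_mul]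
    rw [htop]
    refine (HasKoszulSyzygies.monomial _ fun i j hij => ?_).neg
    have hsupp : ∀ k : Fin m, (Finsupp.single (Sum.inl k) 3 + Finsupp.single (Sum.inr k) 2 :
        Fin m ⊕ Fin m →₀ ℕ).support ⊆ {Sum.inl k, Sum.inr k} := fun k =>
      Finsupp.support_add.trans (Finset.union_subset_union Finsupp.support_single_subset
        Finsupp.support_single_subset)
    refine Finset.disjoint_of_subset_left (hsupp i) (Finset.disjoint_of_subset_right (hsupp j) ?_)
    simp [hij.symm]

theorem LB_ne_zero (i : Fin m) : LB i ≠ 0 := by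
  intro h
  -- At `x_i = 2`, other `x_j = 0`, all `ξ_j = 1`, the value is `4 - 8`; with `x_i = 1` it would
  -- vanish.
  have h1 := congrArg (eval (Sum.elim (fun j => if j = i then 2 else 0) fun _ => 1)) h
  rw [LB_eq] at h1
  simp at h1
  norm_num at h1

end Symbols

/-! ### Products of operators in terms of total symbols. -/

section SymbolCalculus

variable {m : ℕ}

theorem x_mul_normalOrder (i : Fin m) (p : SymbolRing m) :
    x i * normalOrder m p = normalOrder m (X (Sum.inl i) * p) := by
  induction p using MvPolynomial.induction_on' with
  | monomial s c =>
    obtain ⟨α, β, rfl⟩ := exists_joinExp s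
    have h : Finsupp.single (Sum.inl i) 1 + joinExp α β = joinExp (α + Finsupp.single i 1) β := by
      ext (j | j) <;> simp [joinExp, Finsupp.single_apply, add_comm]
    rw [X, monomial_mul, normalOrder_monomial, normalOrder_monomial, h, normalMonomial_joinExp,
      normalMonomial_joinExp, mul_smul_comm, ← mul_assoc, x_mul_xPow, one_mul]
  | add p q hp hq => rw [map_add, mul_add, hp, hq, mul_add, map_add]

theorem d_mul_normalOrder (i : Fin m) (p : SymbolRing m) :
    d i * normalOrder m p =
      normalOrder m (X (Sum.inr i) * p + pderiv (Sum.inl i) p) := by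
  induction p using MvPolynomial.induction_on' with
  | monomial s c =>
    obtain ⟨α, β, rfl⟩ := exists_joinExp s
    have h : Finsupp.single (Sum.inr i) 1 + joinExp α β = joinExp α (β + Finsupp.single i 1) := by
      ext (j | j) <;> simp [joinExp, Finsupp.single_apply, add_comm]
    have h' : joinExp α β - Finsupp.single (Sum.inl i) 1 =
        joinExp (α - Finsupp.single i 1) β := by
      ext (j | j) <;> simp [joinExp, Finsupp.single_apply]
    rw [map_add, pderiv_monomial, X, monomial_mul, normalOrder_monomial, normalOrder_monomial,
      normalOrder_monomial, h, h', normalMonomial_joinExp, normalMonomial_joinExp,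
      normalMonomial_joinExp, mul_smul_comm, ← mul_assoc, d_mul_xPow, add_mul, mul_assoc,
      d_mul_dPow, smul_mul_assoc, smul_add, smul_smul, one_mul]
    rfl
  | add p q hp hq =>
    rw [map_add, mul_add, hp, hq, ← map_add]
    congr 1
    rw [map_add]
    ring

theorem normalOrder_mul_d (i : Fin m) (p : SymbolRing m) :
    normalOrder m p * d i = normalOrder m (p * X (Sum.inr i)) := by
  induction p using MvPolynomial.induction_on' with
  | monomial s c =>
    obtain ⟨α, β, rfl⟩ := exists_joinExp s
    have h : joinExp α β + Finsupp.single (Sum.inr i) 1 = joinExp α (β + Finsupp.single i 1) := by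
      ext (j | j) <;> simp [joinExp, Finsupp.single_apply]
    have hc : dPow β * d i = d i * dPow β :=
      (Finset.noncommProd_commute _ _ _ _ fun j _ => (d_commute i j).pow_right _).symm
    rw [X, monomial_mul, normalOrder_monomial, normalOrder_monomial, h, normalMonomial_joinExp,
      normalMonomial_joinExp, smul_mul_assoc, mul_assoc, hc, d_mul_dPow, mul_one]
  | add p q hp hq => rw [map_add, add_mul, hp, hq, add_mul, map_add]

theorem normalOrder_C (c : ℂ) : normalOrder m (C c) = algebraMap ℂ (D m) c := by
  rw [C_apply, normalOrder_monomial, Algebra.algebraMap_eq_smul_one]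
  congr 1
  have hx : (xPow (fun i => (0 : Fin m ⊕ Fin m →₀ ℕ) (Sum.inl i)) : D m) = 1 :=
    (Finset.noncommProd_eq_pow_card _ _ _ 1 fun _ _ => pow_zero _).trans (one_pow _)
  have hd : (dPow (fun i => (0 : Fin m ⊕ Fin m →₀ ℕ) (Sum.inr i)) : D m) = 1 :=
    (Finset.noncommProd_eq_pow_card _ _ _ 1 fun _ _ => pow_zero _).trans (one_pow _)
  rw [normalMonomial, hx, hd, one_mul]

/-- Each `x_i` has weight `0`, so lowering its exponent does not change the weight. -/
theorem pderiv_inl_mem_weightLT {n : ℕ} (i : Fin m) {q : SymbolRing m}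
    (hq : q ∈ weightLT ℂ (weight01 m) n) :
    pderiv (Sum.inl i) q ∈ weightLT ℂ (weight01 m) n := by
  rw [q.as_sum, map_sum]
  refine sum_mem fun s hs t ht => ?_
  rw [pderiv_monomial, coeff_monomial] at ht
  obtain rfl : s - Finsupp.single (Sum.inl i) 1 = t := by
    by_contra h
    exact ht (if_neg h)
  rw [if_pos rfl] at ht
  have hi : s (Sum.inl i) ≠ 0 := fun h => ht (by simp [h])
  have h1 : s = s - Finsupp.single (Sum.inl i) 1 + Finsupp.single (Sum.inl i) 1 :=
    (tsub_add_cancel_of_le (Finsupp.single_le_iff.mpr (Nat.one_le_iff_ne_zero.mpr hi))).symm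
  have h2 := hq s (mem_support_iff.mp hs)
  rw [h1, map_add] at h2
  omega

/-- The leading part of a product of operators is the product of the symbols. -/
theorem exists_normalOrder_mul {k n : ℕ} {p q : SymbolRing m}
    (hp : p ∈ weightLT ℂ (weight01 m) (k + 1)) (hq : q ∈ weightLT ℂ (weight01 m) (n + 1)) :
    ∃ e ∈ weightLT ℂ (weight01 m) (k + n),
      normalOrder m p * normalOrder m q = normalOrder m (p * q + e) := by
  have hmono : ∀ (s : Fin m ⊕ Fin m →₀ ℕ) (c : ℂ),
      ∃ l, IsWeightedHomogeneous (weight01 m) (monomial s c) l ∧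
        ∀ (n : ℕ) (q : SymbolRing m), q ∈ weightLT ℂ (weight01 m) (n + 1) →
          ∃ e ∈ weightLT ℂ (weight01 m) (l + n),
            normalOrder m (monomial s c) * normalOrder m q =
              normalOrder m (monomial s c * q + e) := by
    intro s c
    refine induction_on_monomial (motive := fun p => ∃ l, IsWeightedHomogeneous (weight01 m) p l ∧
        ∀ (n : ℕ) (q : SymbolRing m), q ∈ weightLT ℂ (weight01 m) (n + 1) →
          ∃ e ∈ weightLT ℂ (weight01 m) (l + n),
            normalOrder m p * normalOrder m q = normalOrder m (p * q + e)) ?_ ?_ s c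
    · refine fun c => ⟨0, isWeightedHomogeneous_C _ c, fun n q _ => ⟨0, zero_mem _, ?_⟩⟩
      rw [normalOrder_C, ← Algebra.smul_def, add_zero, C_mul', map_smul]
    -- A new `x_i` is pulled out on the left and a new `ξ_i` on the right of the first factor, where
    -- normal ordering needs no correction. Only `∂_i` then has to cross `q`, which costs the
    -- derivative of `q` in `x_i`, of no larger order than `q`.
    · rintro p (i | i) ⟨l, hl, ih⟩
      · refine ⟨l, hl.mul (isWeightedHomogeneous_X _ _ _), fun n q hq => ?_⟩
        obtain ⟨e, he, h⟩ := ih n q hq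
        refine ⟨X (Sum.inl i) * e, ?_, ?_⟩
        · rw [mul_comm]
          exact mul_mem_weightLT (n := 0) he
            (IsWeightedHomogeneous.mem_weightLT (isWeightedHomogeneous_X _ _ _))
        · rw [mul_comm p, ← x_mul_normalOrder, mul_assoc, h, x_mul_normalOrder, mul_add, mul_assoc]
      · refine ⟨l + 1, hl.mul (isWeightedHomogeneous_X _ _ _), fun n q hq => ?_⟩
        have hX : X (Sum.inr i) * q ∈ weightLT ℂ (weight01 m) (n + 1 + 1) := by
          rw [mul_comm]
          exact mul_mem_weightLT (n := 1) hq
            (IsWeightedHomogeneous.mem_weightLT (isWeightedHomogeneous_X _ _ _))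
        have hd := pderiv_inl_mem_weightLT i hq
        obtain ⟨e, he, h⟩ := ih (n + 1) (X (Sum.inr i) * q + pderiv (Sum.inl i) q)
          (add_mem hX (weightLT_mono (by omega) hd))
        refine ⟨p * pderiv (Sum.inl i) q + e, add_mem
          (mul_mem_weightLT (IsWeightedHomogeneous.mem_weightLT hl) hd)
          (weightLT_mono (by omega) he), ?_⟩
        rw [← normalOrder_mul_d, mul_assoc, d_mul_normalOrder, h]
        congr 1
        ring
  have hsum : ∀ s ∈ p.support, ∃ e ∈ weightLT ℂ (weight01 m) (k + n),
      normalOrder m (monomial s (coeff s p)) * normalOrder m q =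
        normalOrder m (monomial s (coeff s p) * q + e) := by
    intro s hs
    obtain ⟨l, hl, h⟩ := hmono s (coeff s p)
    have hc := mem_support_iff.mp hs
    have hls : Finsupp.weight (weight01 m) s = l := hl (by rwa [coeff_monomial, if_pos rfl])
    obtain ⟨e, he, h⟩ := h n q hq
    have := hp s hc
    exact ⟨e, weightLT_mono (by omega) he, h⟩
  choose! e he h using hsum
  refine ⟨∑ s ∈ p.support, e s, sum_mem he, ?_⟩
  have hpq : p * q = ∑ s ∈ p.support, monomial s (coeff s p) * q := by
    rw [← Finset.sum_mul, support_sum_monomial_coeff]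
  have hp' : normalOrder m p = ∑ s ∈ p.support, normalOrder m (monomial s (coeff s p)) := by
    rw [← map_sum, support_sum_monomial_coeff]
  rw [hpq, hp', Finset.sum_mul, ← Finset.sum_add_distrib, map_sum]
  exact Finset.sum_congr rfl h

end SymbolCalculus

end LauricellaFB

/-! ### Order filtration on `D` and the symbols of the `ℓ_i`. -/

noncomputable section

namespace LauricellaFB

open MvPolynomial

variable {m : ℕ}

/-- The total symbol as a linear map. -/
def totalSymbolₗ (m : ℕ) : D m →ₗ[ℂ] SymbolRing m :=
  (LinearEquiv.ofBijective (normalOrder m) (normalOrder_bijective m)).symm.toLinearMap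

theorem totalSymbolₗ_normalOrder (p : SymbolRing m) : totalSymbolₗ m (normalOrder m p) = p :=
  (LinearEquiv.ofBijective (normalOrder m) (normalOrder_bijective m)).symm_apply_apply p

theorem normalOrder_totalSymbolₗ (P : D m) : normalOrder m (totalSymbolₗ m P) = P :=
  (LinearEquiv.ofBijective (normalOrder m) (normalOrder_bijective m)).apply_symm_apply P

/-- The operators of order less than `n`. -/
def orderLT (m n : ℕ) : Submodule ℂ (D m) :=
  (weightLT ℂ (weight01 m) n).comap (totalSymbolₗ m)

/-- The part of degree `k` in `ξ` of the total symbol. -/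
def symbolAt (m k : ℕ) : D m →ₗ[ℂ] SymbolRing m :=
  (weightedHomogeneousComponent (weight01 m) k).comp (totalSymbolₗ m)

theorem orderLT_mono {k n : ℕ} (h : k ≤ n) : orderLT m k ≤ orderLT m n :=
  Submodule.comap_mono (weightLT_mono h)

theorem eq_zero_of_mem_orderLT_zero {P : D m} (h : P ∈ orderLT m 0) : P = 0 := by
  rw [← normalOrder_totalSymbolₗ P, eq_zero_of_mem_weightLT_zero h, map_zero]

theorem symbolAt_eq_zero_of_mem_orderLT {P : D m} {k n : ℕ} (hP : P ∈ orderLT m k) (h : k ≤ n) :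
    symbolAt m n P = 0 :=
  weightedHomogeneousComponent_eq_zero_of_mem_weightLT hP h

theorem mem_orderLT_of_symbolAt_eq_zero {P : D m} {k : ℕ} (hP : P ∈ orderLT m (k + 1))
    (h : symbolAt m k P = 0) : P ∈ orderLT m k :=
  mem_weightLT_of_component_eq_zero hP h

theorem normalOrder_mem_orderLT {p : SymbolRing m} {k : ℕ}
    (hp : IsWeightedHomogeneous (weight01 m) p k) : normalOrder m p ∈ orderLT m (k + 1) := by
  change totalSymbolₗ m (normalOrder m p) ∈ weightLT ℂ (weight01 m) (k + 1)
  rw [totalSymbolₗ_normalOrder]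
  exact IsWeightedHomogeneous.mem_weightLT hp

theorem symbolAt_normalOrder {p : SymbolRing m} {k : ℕ}
    (hp : IsWeightedHomogeneous (weight01 m) p k) : symbolAt m k (normalOrder m p) = p := by
  change weightedHomogeneousComponent _ _ (totalSymbolₗ m (normalOrder m p)) = _
  rw [totalSymbolₗ_normalOrder, hp.weightedHomogeneousComponent_same]

theorem mul_mem_orderLT_and_symbolAt_mul {P Q : D m} {k n : ℕ} (hP : P ∈ orderLT m (k + 1))
    (hQ : Q ∈ orderLT m (n + 1)) :
    P * Q ∈ orderLT m (k + n + 1) ∧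
      symbolAt m (k + n) (P * Q) = symbolAt m k P * symbolAt m n Q := by
  obtain ⟨e, he, h⟩ := exists_normalOrder_mul hP hQ
  rw [normalOrder_totalSymbolₗ, normalOrder_totalSymbolₗ] at h
  have hT := totalSymbolₗ_normalOrder (totalSymbolₗ m P * totalSymbolₗ m Q + e)
  rw [← h] at hT
  constructor
  · change totalSymbolₗ m (P * Q) ∈ weightLT ℂ (weight01 m) (k + n + 1)
    rw [hT]
    refine add_mem ?_ (weightLT_mono (by omega) he)
    have := mul_mem_weightLT hP hQ
    rwa [show k + 1 + n = k + n + 1 by ring] at this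
  · change weightedHomogeneousComponent _ _ (totalSymbolₗ m (P * Q)) = _
    rw [hT, map_add, weightedHomogeneousComponent_eq_zero_of_mem_weightLT he le_rfl, add_zero]
    exact component_mul_of_mem_weightLT hP hQ

theorem mul_mem_orderLT {P Q : D m} {k n : ℕ} (hP : P ∈ orderLT m (k + 1))
    (hQ : Q ∈ orderLT m (n + 1)) : P * Q ∈ orderLT m (k + n + 1) :=
  (mul_mem_orderLT_and_symbolAt_mul hP hQ).1

theorem symbolAt_mul {P Q : D m} {k n : ℕ} (hP : P ∈ orderLT m (k + 1))
    (hQ : Q ∈ orderLT m (n + 1)) :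
    symbolAt m (k + n) (P * Q) = symbolAt m k P * symbolAt m n Q :=
  (mul_mem_orderLT_and_symbolAt_mul hP hQ).2

theorem initialForm_eq_symbolAt (P : D m) :
    ∃ k, P ∈ orderLT m (k + 1) ∧ initialForm P = symbolAt m k P :=
  ⟨_, mem_weightLT_weightedTotalDegree _ (totalSymbolₗ m P), rfl⟩

theorem initialForm_eq_of_symbolAt_ne_zero {P : D m} {k : ℕ} (hP : P ∈ orderLT m (k + 1))
    (h : symbolAt m k P ≠ 0) : initialForm P = symbolAt m k P := by
  have h1 : weightedTotalDegree (weight01 m) (totalSymbolₗ m P) = k := by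
    refine le_antisymm (Finset.sup_le fun s hs => ?_) ?_
    · exact Nat.lt_succ_iff.mp (hP s (mem_support_iff.mp hs))
    · by_contra hlt
      exact h (weightedHomogeneousComponent_eq_zero _ _ (not_le.mp hlt))
  rw [← h1]
  rfl

theorem sub_mem_orderLT {P Q : D m} {k : ℕ} (hP : P ∈ orderLT m k) (hQ : Q ∈ orderLT m k) :
    P - Q ∈ orderLT m k := by
  change totalSymbolₗ m (P - Q) ∈ weightLT ℂ (weight01 m) k
  rw [map_sub (totalSymbolₗ m)]
  exact sub_mem hP hQ

theorem algebraMap_mem_orderLT (c : ℂ) : algebraMap ℂ (D m) c ∈ orderLT m 1 := by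
  rw [← normalOrder_C]
  exact normalOrder_mem_orderLT (isWeightedHomogeneous_C _ c)

theorem x_eq_normalOrder (i : Fin m) : x i = normalOrder m (X (Sum.inl i)) := by
  have := x_mul_normalOrder i (C 1)
  rwa [normalOrder_C, map_one, mul_one, map_one, mul_one] at this

theorem euler_eq_normalOrder (i : Fin m) :
    euler i = normalOrder m (X (Sum.inl i) * X (Sum.inr i)) := by
  rw [euler, x_eq_normalOrder, normalOrder_mul_d]

theorem isWeightedHomogeneous_euler (i : Fin m) : IsWeightedHomogeneous (weight01 m)
    (X (Sum.inl i) * X (Sum.inr i) : SymbolRing m) 1 :=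
  (isWeightedHomogeneous_X _ _ (Sum.inl i)).mul (isWeightedHomogeneous_X _ _ (Sum.inr i))

theorem x_mem_orderLT (i : Fin m) : x i ∈ orderLT m 1 := by
  rw [x_eq_normalOrder]
  exact normalOrder_mem_orderLT (isWeightedHomogeneous_X _ _ _)

theorem symbolAt_x (i : Fin m) : symbolAt m 0 (x i) = X (Sum.inl i) := by
  rw [x_eq_normalOrder]
  exact symbolAt_normalOrder (isWeightedHomogeneous_X _ _ _)

theorem euler_mem_orderLT (i : Fin m) : euler i ∈ orderLT m 2 := by
  rw [euler_eq_normalOrder]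
  exact normalOrder_mem_orderLT (isWeightedHomogeneous_euler i)

theorem symbolAt_euler (i : Fin m) :
    symbolAt m 1 (euler i) = X (Sum.inl i) * X (Sum.inr i) := by
  rw [euler_eq_normalOrder]
  exact symbolAt_normalOrder (isWeightedHomogeneous_euler i)

theorem add_algebraMap_mem_orderLT {P : D m} (hP : P ∈ orderLT m 2) (c : ℂ) :
    P + algebraMap ℂ (D m) c ∈ orderLT m 2 :=
  add_mem hP (orderLT_mono one_le_two (algebraMap_mem_orderLT c))

theorem symbolAt_add_algebraMap (P : D m) (c : ℂ) :
    symbolAt m 1 (P + algebraMap ℂ (D m) c) = symbolAt m 1 P := by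
  rw [map_add, symbolAt_eq_zero_of_mem_orderLT (algebraMap_mem_orderLT c) le_rfl, add_zero]

theorem sum_euler_mem_orderLT : ∑ j : Fin m, euler j ∈ orderLT m 2 :=
  sum_mem fun j _ => euler_mem_orderLT j

theorem ellB_mem_orderLT (a b : Fin m → ℂ) (c : ℂ) (i : Fin m) : ellB a b c i ∈ orderLT m 3 :=
  sub_mem_orderLT
    (mul_mem_orderLT (k := 1) (n := 1) (euler_mem_orderLT i)
      (add_algebraMap_mem_orderLT sum_euler_mem_orderLT _))
    (mul_mem_orderLT (k := 1) (n := 1)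
      (mul_mem_orderLT (k := 0) (n := 1) (x_mem_orderLT i)
        (add_algebraMap_mem_orderLT (euler_mem_orderLT i) _))
      (add_algebraMap_mem_orderLT (euler_mem_orderLT i) _))

/-- Symbols multiply, and the constants from `a`, `b`, `c` are added to operators of order one, so
they leave the symbol unchanged. -/
theorem symbolAt_ellB (a b : Fin m → ℂ) (c : ℂ) (i : Fin m) :
    symbolAt m 2 (ellB a b c i) = LB i := by
  have ha := add_algebraMap_mem_orderLT (euler_mem_orderLT i) (a i)
  have hb := add_algebraMap_mem_orderLT (euler_mem_orderLT i) (b i)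
  have hs := add_algebraMap_mem_orderLT (sum_euler_mem_orderLT (m := m)) (c - 1)
  have h1 := symbolAt_mul (k := 1) (n := 1) (euler_mem_orderLT i) hs
  have h2 := symbolAt_mul (k := 0) (n := 1) (x_mem_orderLT i) ha
  have h3 := symbolAt_mul (k := 1) (n := 1)
    (mul_mem_orderLT (k := 0) (n := 1) (x_mem_orderLT i) ha) hb
  rw [zero_add] at h2
  rw [ellB, map_sub (symbolAt m 2), h1, h3, h2, LB_eq]
  simp only [symbolAt_add_algebraMap, map_sum, symbolAt_euler, symbolAt_x]
  ring

/-! ### Commutation relations and the lift of Koszul syzygies to `D`. -/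

theorem x_mul_euler_of_ne {i j : Fin m} (h : i ≠ j) : x i * euler j = euler j * x i := by
  have := d_mul_normalOrder j (X (Sum.inl i))
  rw [pderiv_X_of_ne (by simpa using h), add_zero, ← x_eq_normalOrder, mul_comm,
    ← normalOrder_mul_d, ← x_eq_normalOrder] at this
  rw [euler, mul_assoc, this, ← mul_assoc, ← mul_assoc, (x_commute i j).eq]

theorem euler_mul_x (i : Fin m) : euler i * x i = x i * euler i + x i := by
  have := d_mul_normalOrder i (X (Sum.inl i))
  rw [pderiv_X_self, map_add, ← x_eq_normalOrder, mul_comm,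
    ← normalOrder_mul_d, ← x_eq_normalOrder, ← C_1, normalOrder_C, map_one] at this
  rw [euler, mul_assoc, this, mul_add, mul_one]

theorem euler_commute (i j : Fin m) : Commute (euler i) (euler j) := by
  rcases eq_or_ne i j with rfl | h
  · exact Commute.refl _
  · have hd : d i * euler j = euler j * d i := by
      have := d_mul_normalOrder i (X (Sum.inl j))
      rw [pderiv_X_of_ne (by simpa using h.symm), add_zero, ← x_eq_normalOrder, mul_comm,
        ← normalOrder_mul_d, ← x_eq_normalOrder] at this
      rw [euler, ← mul_assoc, this, mul_assoc, mul_assoc, (d_commute i j).eq]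
    change euler i * euler j = euler j * euler i
    conv_lhs => rw [euler, mul_assoc, hd, ← mul_assoc, x_mul_euler_of_ne h, mul_assoc]
    rfl

theorem sum_euler_mul_x (i : Fin m) :
    (∑ j, euler j) * x i = x i * (∑ j, euler j) + x i := by
  rw [Finset.sum_mul, Finset.mul_sum, ← Finset.add_sum_erase _ _ (Finset.mem_univ i),
    ← Finset.add_sum_erase _ (fun j => x i * euler j) (Finset.mem_univ i), euler_mul_x,
    Finset.sum_congr rfl fun j hj => (x_mul_euler_of_ne (Finset.ne_of_mem_erase hj).symm).symm]
  abel

/-- Here `e`, `f` play `θ_i`, `θ_j`, while `s` is `∑ θ_k + c - 1` and `p`, `q` are the parts of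
`ℓ_i`, `ℓ_j` that begin with `x_i`, `x_j`. As `[s, p] = p` and `[s, q] = q`, the commutator of `e s
- p` and `f s - q` is `f p - e q = e (f s - q) - f (e s - p)`, which is the claim rearranged. -/
theorem sub_mul_sub_comm_of_relations {R : Type*} [Ring R] {e f s p q : R}
    (hsp : s * p = p * s + p) (hsq : s * q = q * s + q) (heq : Commute e q) (hfp : Commute f p)
    (hes : Commute e s) (hfs : Commute f s) (hef : Commute e f) (hpq : Commute p q) :
    (f * s - q - f) * (e * s - p) = (e * s - p - e) * (f * s - q) := by
  have h1 : f * s * (e * s) = e * s * (f * s) :=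
    ((hef.symm.mul_left hes.symm).mul_right (hfs.mul_left (Commute.refl s))).eq
  have h2 : f * s * p = p * (f * s) + f * p := by
    rw [mul_assoc, hsp, mul_add, ← mul_assoc, hfp.eq, mul_assoc]
  have h3 : e * s * q = q * (e * s) + e * q := by
    rw [mul_assoc, hsq, mul_add, ← mul_assoc, heq.eq, mul_assoc]
  have h4 : f * (e * s) = e * (f * s) := by rw [← mul_assoc, ← hef.eq, mul_assoc]
  simp only [sub_mul, mul_sub, h1, h2, h3, h4, hpq.eq]
  abel

/-- A noncommutative Koszul syzygy: the coefficients stay on the left, so symmetry of `F j * G i` is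
all that is needed. -/
theorem sum_sum_mul_mul_eq_zero {ι R : Type*} [Fintype ι] [Ring R] [IsAddTorsionFree R]
    {u : ι → ι → R} {F G : ι → R} (hu : ∀ i j, u i j = -u j i)
    (h : ∀ i j, F j * G i = F i * G j) : ∑ i, (∑ j, u i j * F j) * G i = 0 := by
  simp only [Finset.sum_mul]
  refine sum_sum_eq_zero_of_antisymm fun i j => ?_
  rw [hu i j, mul_assoc, h i j, mul_assoc, neg_mul]

theorem sum_sub_mul {ι R : Type*} [Fintype ι] [Ring R] (F G H : ι → R) :
    ∑ i, (F i - G i) * H i = ∑ i, F i * H i - ∑ i, G i * H i := by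
  simp only [sub_mul, Finset.sum_sub_distrib]

instance : IsAddTorsionFree (D m) where
  nsmul_right_injective n hn P Q h := by
    have h' : (n : ℂ) • P = (n : ℂ) • Q := by
      simpa only [Nat.cast_smul_eq_nsmul] using h
    exact smul_right_injective (D m) (Nat.cast_ne_zero.mpr hn : (n : ℂ) ≠ 0) h'

/-- The relation behind the commutator `[ℓ_i, ℓ_j] = θ_i ℓ_j - θ_j ℓ_i`. -/
theorem ellB_sub_euler_mul_ellB (a b : Fin m → ℂ) (c : ℂ) (i j : Fin m) :
    (ellB a b c j - euler j) * ellB a b c i = (ellB a b c i - euler i) * ellB a b c j := by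
  rcases eq_or_ne i j with rfl | hij
  · rfl
  have hcx : ∀ (z : ℂ) (P : D m), Commute (algebraMap ℂ (D m) z) P := Algebra.commutes
  set s : D m := ∑ k, euler k + algebraMap ℂ (D m) (c - 1) with hs
  set A : Fin m → D m := fun k =>
    (euler k + algebraMap ℂ (D m) (a k)) * (euler k + algebraMap ℂ (D m) (b k)) with hA
  have hℓ : ∀ k, ellB a b c k = euler k * s - x k * A k := fun k => by
    rw [ellB, mul_assoc (x k)]
  have hes : ∀ k, Commute (euler k) s := fun k =>
    (Commute.sum_right _ _ _ fun l _ => euler_commute k l).add_right (hcx _ _).symm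
  have hPA : ∀ (P : D m) k, Commute P (euler k) → Commute P (A k) := fun P k h =>
    (h.add_right (hcx _ _).symm).mul_right (h.add_right (hcx _ _).symm)
  -- Multiplication by `x k` raises the degree by one, and `s` is the degree operator up to a
  -- constant.
  have hsx : ∀ k, s * x k = x k * s + x k := fun k => by
    rw [hs, add_mul, sum_euler_mul_x, (hcx _ _).eq, mul_add]
    abel
  have hsp : ∀ k, s * (x k * A k) = x k * A k * s + x k * A k := fun k => by
    rw [← mul_assoc, hsx, add_mul, mul_assoc (x k) s, (hPA s k (hes k).symm).eq,
      mul_assoc (x k) (A k)]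
  have hep : ∀ k l, k ≠ l → Commute (euler k) (x l * A l) := fun k l h =>
    Commute.mul_right (x_mul_euler_of_ne h.symm).symm (hPA _ _ (euler_commute k l))
  have hpp : Commute (x i * A i) (x j * A j) := by
    have hxe : ∀ k l, k ≠ l → Commute (x k) (A l) := fun k l h => hPA _ _ (x_mul_euler_of_ne h)
    have hAA : Commute (A i) (A j) := hPA _ _ (hPA _ _ (euler_commute j i)).symm
    exact ((x_commute i j).mul_right (hxe i j hij)).mul_left
      ((hxe j i hij.symm).symm.mul_right hAA)
  rw [hℓ, hℓ]
  exact sub_mul_sub_comm_of_relations (R := D m) (hsp i) (hsp j) (hep i j hij) (hep j i hij.symm) (hes i)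
    (hes j) (euler_commute i j) hpp

/-! ### Reduction of cancelling combinations and the initial ideal. -/

/-- Induction on a bound for the orders of the `Q i`: whenever leading symbols cancel, the sum is
rewritten with coefficients of smaller order. -/
theorem symbolAt_mem_of_sum (a b : Fin m → ℂ) (c : ℂ) (k n : ℕ) (Q : Fin m → D m)
    (hQ : ∀ i, Q i ∈ orderLT m n) (hP : ∑ i, Q i * ellB a b c i ∈ orderLT m (k + 1)) :
    symbolAt m k (∑ i, Q i * ellB a b c i) ∈ Ideal.span (Set.range (LB : Fin m → SymbolRing m)) := by
  induction n generalizing Q with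
  | zero =>
    rw [Finset.sum_eq_zero fun i _ => by rw [eq_zero_of_mem_orderLT_zero (hQ i), zero_mul],
      map_zero]
    exact zero_mem _
  | succ n ih =>
    have hmem : ∑ i, Q i * ellB a b c i ∈ orderLT m (n + 2 + 1) :=
      sum_mem fun i _ => mul_mem_orderLT (hQ i) (ellB_mem_orderLT a b c i)
    have hsym : symbolAt m (n + 2) (∑ i, Q i * ellB a b c i) = ∑ i, symbolAt m n (Q i) * LB i := by
      rw [map_sum]
      refine Finset.sum_congr rfl fun i _ => ?_
      rw [symbolAt_mul (hQ i) (ellB_mem_orderLT a b c i), symbolAt_ellB]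
    -- The sum has order at most `n + 2`. Below `k` the symbol is zero, at `k` it is visibly a
    -- combination of the `L_i`, and above `k` the leading symbols must cancel.
    rcases lt_trichotomy (n + 2) k with h | rfl | h
    · rw [symbolAt_eq_zero_of_mem_orderLT hmem h]
      exact zero_mem _
    · rw [hsym]
      exact sum_mem fun i _ => Ideal.mul_mem_left _ _ (Ideal.subset_span ⟨i, rfl⟩)
    rw [symbolAt_eq_zero_of_mem_orderLT hP h] at hsym
    rcases (hasKoszulSyzygies_LB m).homogeneous isWeightedHomogeneous_LB
      (fun i => weightedHomogeneousComponent_isWeightedHomogeneous n (totalSymbolₗ m (Q i)))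
      hsym.symm with hz | ⟨l, u, rfl, hu, hul, huq⟩
    · exact ih Q (fun i => mem_orderLT_of_symbolAt_eq_zero (hQ i) (hz i)) hP
    have hℓ : ∀ j, ellB a b c j - euler j ∈ orderLT m (2 + 1) := fun j =>
      sub_mem_orderLT (ellB_mem_orderLT a b c j) (orderLT_mono (by omega) (euler_mem_orderLT j))
    have hℓs : ∀ j, symbolAt m 2 (ellB a b c j - euler j) = LB j := fun j => by
      rw [map_sub (symbolAt m 2), symbolAt_ellB,
        symbolAt_eq_zero_of_mem_orderLT (euler_mem_orderLT j) le_rfl, sub_zero]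
    have hU := fun i j => normalOrder_mem_orderLT (hul i j)
    -- The Koszul coefficients are lifted with `ℓ_j - θ_j` in place of `L_j`: the symbol is that of
    -- `Q i`, and the correction `-θ_j` makes `∑ R i * ℓ_i` vanish exactly rather than only to
    -- leading order.
    set R : Fin m → D m := fun i => ∑ j, normalOrder m (u i j) * (ellB a b c j - euler j) with hR
    have hRmem : ∀ i, R i ∈ orderLT m (l + 2 + 1) := fun i =>
      sum_mem fun j _ => mul_mem_orderLT (hU i j) (hℓ j)
    have hRsym : ∀ i, symbolAt m (l + 2) (R i) = symbolAt m (l + 2) (Q i) := fun i => by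
      refine Eq.trans ?_ (huq i).symm
      rw [hR, map_sum]
      refine Finset.sum_congr rfl fun j _ => ?_
      rw [symbolAt_mul (hU i j) (hℓ j), hℓs, symbolAt_normalOrder (hul i j)]
    have hRsum : ∑ i, R i * ellB a b c i = 0 := by
      exact sum_sum_mul_mul_eq_zero (R := D m)
        (fun i j => (congrArg (normalOrder m) (hu i j)).trans (map_neg _ _))
        (ellB_sub_euler_mul_ellB a b c)
    have hQR : ∑ i, (Q i - R i) * ellB a b c i = ∑ i, Q i * ellB a b c i := by
      have := sum_sub_mul (R := D m) Q R (ellB a b c)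
      rwa [hRsum, sub_zero (G := D m)] at this
    rw [← hQR] at hP ⊢
    refine ih _ (fun i => mem_orderLT_of_symbolAt_eq_zero
      (sub_mem_orderLT (hQ i) (hRmem i)) ?_) hP
    rw [map_sub (symbolAt m _), hRsym, sub_self]

theorem initialForm_ellB (a b : Fin m → ℂ) (c : ℂ) (i : Fin m) :
    initialForm (ellB a b c i) = LB i := by
  rw [initialForm_eq_of_symbolAt_ne_zero (ellB_mem_orderLT a b c i), symbolAt_ellB]
  rw [symbolAt_ellB]
  exact LB_ne_zero i

theorem initialIdeal_idealB (a b : Fin m → ℂ) (c : ℂ) :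
    initialIdeal (idealB a b c) = Ideal.span (Set.range (LB : Fin m → SymbolRing m)) := by
  refine le_antisymm (Ideal.span_le.mpr ?_) (Ideal.span_le.mpr ?_)
  · rintro _ ⟨P, hP, rfl⟩
    obtain ⟨Q, rfl⟩ := (Submodule.mem_span_range_iff_exists_fun (D m)).mp hP
    simp only [smul_eq_mul]
    obtain ⟨k, hk, h⟩ := initialForm_eq_symbolAt (∑ i, Q i * ellB a b c i)
    rw [SetLike.mem_coe, h]
    choose n hn _ using fun i => initialForm_eq_symbolAt (Q i)
    exact symbolAt_mem_of_sum a b c k (Finset.univ.sup fun i => n i + 1) Q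
      (fun i => orderLT_mono (Finset.le_sup (f := fun i => n i + 1) (Finset.mem_univ i)) (hn i)) hk
  · rintro _ ⟨i, rfl⟩
    exact Ideal.subset_span
      ⟨ellB a b c i, Ideal.subset_span ⟨i, rfl⟩, (initialForm_ellB a b c i).symm⟩

end LauricellaFB

end

theorem mainTheorem6 (m : ℕ) (a b : Fin m → ℂ) (c : ℂ) :
    (∀ i : Fin m, LauricellaFB.initialForm (LauricellaFB.ellB a b c i) = LauricellaFB.LB i) ∧
      LauricellaFB.characteristicVariety (LauricellaFB.idealB a b c) =
        {p : Fin m ⊕ Fin m → ℂ | ∀ i : Fin m, MvPolynomial.eval p (LauricellaFB.LB i) = 0} := by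
  refine ⟨LauricellaFB.initialForm_ellB a b c, ?_⟩
  rw [LauricellaFB.characteristicVariety, LauricellaFB.initialIdeal_idealB,
    MvPolynomial.zeroLocus_span]
  simp
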